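/- Let $n\ge 1$. The hypercube $\mathcal{Q}_n$ is the graph whose vertices are the subsets of $\{1,\dots,n\}$, two of them being adjacent when their symmetric difference has exactly one element. Call an independent set of $\mathcal{Q}_n$ balanced if it contains equally many vertices of even size and of odd size (as subsets of $\{1,\dots,n\}$). Then the largest balanced independent set in $\mathcal{Q}_n$ has size \[ 2^{n-1}-2\binom{n-2}{(n-2)/2}\ \text{ if } n \text{ is even},\qquad 2^{n-1}-\binom{n-1}{(n-1)/2}\ \text{ if } n \text{ is odd}. \] -/

import Mathlib

/-- The discrete hypercube `Q_n`: the vertices are the subsets of an `n`-element set, and two of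
them are adjacent when their symmetric difference has exactly one element. -/
def hypercube (n : ℕ) : SimpleGraph (Finset (Fin n)) where
  Adj s t := (symmDiff s t).card = 1
  symm := ⟨fun s t h => by rwa [symmDiff_comm]⟩
  loopless := ⟨fun s h => by simp at h⟩

/-- A balanced independent set of `Q_n`: an independent set with as many vertices of even size
as vertices of odd size. -/
def IsBalancedIndepSet (n : ℕ) (S : Finset (Finset (Fin n))) : Prop :=
  (hypercube n).IsIndepSet (S : Set (Finset (Fin n))) ∧
    (S.filter fun x => Even x.card).card = (S.filter fun x => Odd x.card).card

/-!
The even vertices of `Q_{m+1}` correspond bijectively to all the subsets of an `m`-element set by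
forgetting one coordinate (`dropZero`), and so do the odd ones. An even and an odd vertex are
adjacent exactly when their traces are at Hamming distance at most `1`. A balanced independent set
of `Q_{m+1}` is therefore a pair of equally large families `A`, `B` in the `m`-dimensional cube
with every member of `A` at distance at least `2` from every member of `B` (`IsSeparated`), and
the question is how large such families can be.

For the upper bound, `A` is pushed down and `B` is pushed up by `UV`-compressions with
`#V = #U + 1`, in the manner of Frankl and Füredi's proof of Harper's theorem. Taken in order of
increasing `#U`, these compressions keep the pair separated (`IsSeparated.compression`), and a
pair stable under all of them has every member of `A` strictly smaller than every member of `B`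
(`IsSeparated.exists_card_lt`). If `m = 2 * k`, a family `A` with more members than there are sets
of size less than `k` then forces every member of `B` above level `k`, which leaves too little
room for `B`. If `m = 2 * k + 1`, large `A` and `B` lie on levels at most `k` and at least `k + 1`
respectively; the sets of `B` of size `k + 1` are too many, by the Kruskal–Katona theorem in
Lovász's form, for their shadow, which `A` avoids, to be small.

The bound is attained by the sets below and above the middle layer if `m` is even, and by the
product of that example with an edge if `m` is odd.
-/

open Finset UV
open scoped symmDiff FinsetFamily

/-! ### Separated pairs of families -/

/-- Two families of finite sets are separated when every member of the one is at Hamming distance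
at least `2` from every member of the other. -/
def IsSeparated {α : Type*} [DecidableEq α] (A B : Finset (Finset α)) : Prop :=
  ∀ x ∈ A, ∀ y ∈ B, 2 ≤ #(x ∆ y)

lemma IsSeparated.symm {α : Type*} [DecidableEq α] {A B : Finset (Finset α)}
    (h : IsSeparated A B) : IsSeparated B A := fun y hy x hx => by
  rw [symmDiff_comm]; exact h x hx y hy

lemma IsSeparated.not_agree_off {α : Type*} [DecidableEq α] {A B : Finset (Finset α)}
    (h : IsSeparated A B) {x y : Finset α} (hx : x ∈ A) (hy : y ∈ B) (e : α) :
    ¬ ∀ i, i ≠ e → (i ∈ x ↔ i ∈ y) := by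
  intro he
  have hsub : x ∆ y ⊆ {e} := by
    intro i hi
    by_contra hne
    have := he i (by simpa using hne)
    rw [mem_symmDiff] at hi
    grind
  have h1 := card_le_card hsub
  have h2 := h x hx y hy
  simp at h1
  omega

lemma exists_agree_off_of_card_symmDiff_lt_two {α : Type*} [DecidableEq α] [Nonempty α]
    {x y : Finset α} (h : #(x ∆ y) < 2) : ∃ e, ∀ i, i ≠ e → (i ∈ x ↔ i ∈ y) := by
  obtain ⟨e, he⟩ := card_le_one_iff_subset_singleton.1 (Nat.lt_succ_iff.1 h)
  refine ⟨e, fun i hi => ?_⟩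
  by_contra hne
  have : i ∈ x ∆ y := by rw [mem_symmDiff]; grind
  exact hi (by simpa using he this)

/-! ### Compressions of separated pairs -/

/-- A moved set stays at distance at least `2` from a set of `B` to which the opposite
compression does not apply, as soon as `B` is stable under the opposite compressions by one size
smaller. -/
lemma IsSeparated.two_le_card_symmDiff_compress {α : Type*} [DecidableEq α]
    {A B : Finset (Finset α)} (h : IsSeparated A B) {U V : Finset α} (hUV : Disjoint U V)
    (hU : U = ∅ → #V ≤ 1) (hV : V = ∅ → #U ≤ 1)
    (hB : ∀ u ∈ U, ∀ v ∈ V, ∀ y ∈ B, compress (V.erase v) (U.erase u) y ∈ B)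
    {x y : Finset α} (hx : x ∈ A) (hy : y ∈ B) (hUx : Disjoint U x) (hVx : V ⊆ x)
    (hyUV : ¬ (Disjoint V y ∧ U ⊆ y)) :
    2 ≤ #(((x ∪ U) \ V) ∆ y) := by
  by_contra hlt
  have : Nonempty α := by
    by_contra hne
    rw [not_nonempty_iff] at hne
    exact hyUV ⟨by simp [Subsingleton.elim V ∅], by simp [Subsingleton.elim U ∅]⟩
  obtain ⟨e, he⟩ := exists_agree_off_of_card_symmDiff_lt_two (not_le.1 hlt)
  simp only [disjoint_left, subset_iff] at hUV hUx hVx hyUV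
  simp only [mem_sdiff, mem_union] at he
  have heUV : e ∈ U ∨ e ∈ V := by
    by_contra hno
    push Not at hno
    refine hyUV ⟨fun i hi hiy => ?_, fun i hi => ?_⟩
    · have := he i (by rintro rfl; exact hno.2 hi)
      grind
    · have := he i (by rintro rfl; exact hno.1 hi)
      have := @hUV i hi
      grind
  -- Compressing `y` by `V.erase v` and `U.erase u` gives a set that agrees with `x` except at
  -- whichever of `u`, `v` is not the exceptional element `e`.
  have key : ∀ u ∈ U, ∀ v ∈ V, (e = u ∨ e = v) → False := by
    intro u hu v hv huv
    have hmem := hB u hu v hv y hy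
    have hcomp : compress (V.erase v) (U.erase u) y = (y ∪ V.erase v) \ U.erase u := by
      refine compress_of_disjoint_of_le ?_ ?_
      · rw [disjoint_left]
        intro i hi hiy
        rw [mem_erase] at hi
        have := @hUV i
        have := he i (by rintro rfl; rcases huv with rfl | rfl <;> grind)
        grind
      · intro i hi
        rw [mem_erase] at hi
        have := @hUV i
        have := he i (by rintro rfl; rcases huv with rfl | rfl <;> grind)
        grind
    rw [hcomp] at hmem
    rcases huv with rfl | rfl
    · refine h.not_agree_off hx hmem v fun i hi => ?_
      have h1 := @hUV i
      have h2 := @hUx i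
      have h3 := @hVx i
      have h4 := he i
      simp only [mem_sdiff, mem_union, mem_erase]
      by_cases hie : i = e
      · subst hie
        have h5 : i ∉ y := by
          intro hiy
          refine hyUV ⟨fun j hj hjy => ?_, fun j hj => ?_⟩
          · have := he j (by rintro rfl; exact h1 hu hj)
            grind
          · by_cases hji : j = i
            · exact hji ▸ hiy
            · have := he j hji
              have := @hUV j hj
              grind
        grind
      · grind
    · refine h.not_agree_off hx hmem u fun i hi => ?_
      have h1 := @hUV i
      have h2 := @hUx i
      have h3 := @hVx i
      have h4 := he i
      simp only [mem_sdiff, mem_union, mem_erase]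
      by_cases hie : i = e
      · subst hie
        have h5 : i ∈ y := by
          by_contra hiy
          refine hyUV ⟨fun j hj hjy => ?_, fun j hj => ?_⟩
          · by_cases hji : j = i
            · exact hiy (hji ▸ hjy)
            · have := he j hji
              grind
          · have := he j (by rintro rfl; exact h1 hj hv)
            have := @hUV j hj
            grind
        grind
      · grind
  rcases heUV with heU | heV
  · rcases V.eq_empty_or_nonempty with rfl | ⟨v, hv⟩
    · have hUe := card_le_one.1 (hV rfl)
      refine h.not_agree_off hx hy e fun i hi => ?_
      have := he i hi
      have h2 : i ∉ U := fun hiU => hi (hUe i hiU e heU)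
      simp at this
      grind
    · exact key e heU v hv (Or.inl rfl)
  · rcases U.eq_empty_or_nonempty with rfl | ⟨u, hu⟩
    · have hVe := card_le_one.1 (hU rfl)
      refine h.not_agree_off hx hy e fun i hi => ?_
      have := he i hi
      have h2 : i ∉ V := fun hiV => hi (hVe i hiV e heV)
      simp at this
      grind
    · exact key u hu e heV (Or.inr rfl)

/-- Compressing `A` along `(U, V)` and `B` along `(V, U)` keeps the pair separated, provided that
it is stable under these compressions with one element removed from each of `U` and `V`. -/
lemma IsSeparated.compression {α : Type*} [DecidableEq α]
    {A B : Finset (Finset α)} (h : IsSeparated A B) {U V : Finset α} (hUV : Disjoint U V)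
    (hU : U = ∅ → #V ≤ 1) (hV : V = ∅ → #U ≤ 1)
    (hA : ∀ u ∈ U, ∀ v ∈ V, ∀ x ∈ A, compress (U.erase u) (V.erase v) x ∈ A)
    (hB : ∀ u ∈ U, ∀ v ∈ V, ∀ y ∈ B, compress (V.erase v) (U.erase u) y ∈ B) :
    IsSeparated (𝓒 U V A) (𝓒 V U B) := by
  -- The case where only the member of `A` moves, stated so that it also covers the mirror image.
  have moved : ∀ {A B : Finset (Finset α)} {U V : Finset α}, IsSeparated A B → Disjoint U V →
      (U = ∅ → #V ≤ 1) → (V = ∅ → #U ≤ 1) →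
      (∀ u ∈ U, ∀ v ∈ V, ∀ y ∈ B, compress (V.erase v) (U.erase u) y ∈ B) →
      ∀ x ∈ A, compress U V x ∉ A → ∀ y ∈ B, compress V U y ∈ B →
      2 ≤ #(compress U V x ∆ y) := by
    intro A B U V h hUV hU hV hB x hx hxA y hy hyB
    have hform : Disjoint U x ∧ V ⊆ x := by
      by_contra hno
      refine hxA ?_
      rw [UV.compress, if_neg hno]
      exact hx
    have hcx : compress U V x = (x ∪ U) \ V := compress_of_disjoint_of_le hform.1 hform.2
    rw [hcx]
    by_cases hyUV : Disjoint V y ∧ U ⊆ y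
    · have hcy : compress V U y = (y ∪ V) \ U := compress_of_disjoint_of_le hyUV.1 hyUV.2
      rw [hcy] at hyB
      have heq : ((x ∪ U) \ V) ∆ y = x ∆ ((y ∪ V) \ U) := by
        obtain ⟨h1, h2⟩ := hform
        obtain ⟨h3, h4⟩ := hyUV
        rw [disjoint_left] at h1 h3 hUV
        ext i
        have := @h1 i
        have := @h2 i
        have := @h3 i
        have := @h4 i
        have := @hUV i
        simp only [mem_symmDiff, mem_sdiff, mem_union]
        grind
      rw [heq]
      exact h x hx _ hyB
    · exact h.two_le_card_symmDiff_compress hUV hU hV hB hx hy hform.1 hform.2 hyUV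
  intro x' hx' y' hy'
  rw [mem_compression] at hx' hy'
  rcases hx' with ⟨hx, hxA⟩ | ⟨hx', x, hx, rfl⟩ <;> rcases hy' with ⟨hy, hyB⟩ | ⟨hy', y, hy, rfl⟩
  · exact h _ hx _ hy
  · rw [symmDiff_comm]
    exact moved h.symm hUV.symm hV hU (fun v hv u hu => hA u hu v hv) y hy hy' x' hx hxA
  · exact moved h hUV hU hV hB x hx hx' y' hy hyB
  · -- Both sets move: their symmetric difference is unchanged.
    have hformx : Disjoint U x ∧ V ⊆ x := by
      by_contra hno
      refine hx' ?_
      rw [UV.compress, if_neg hno]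
      exact hx
    have hformy : Disjoint V y ∧ U ⊆ y := by
      by_contra hno
      refine hy' ?_
      rw [UV.compress, if_neg hno]
      exact hy
    have hcx : compress U V x = (x ∪ U) \ V := compress_of_disjoint_of_le hformx.1 hformx.2
    have hcy : compress V U y = (y ∪ V) \ U := compress_of_disjoint_of_le hformy.1 hformy.2
    have heq : ((x ∪ U) \ V) ∆ ((y ∪ V) \ U) = x ∆ y := by
      obtain ⟨h1, h2⟩ := hformx
      obtain ⟨h3, h4⟩ := hformy
      rw [disjoint_left] at h1 h3 hUV
      ext i
      have := @h1 i
      have := @h2 i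
      have := @h3 i
      have := @h4 i
      have := @hUV i
      simp only [mem_symmDiff, mem_sdiff, mem_union]
      grind
    rw [hcx, hcy, heq]
    exact h x hx y hy

lemma sum_compression_le {α : Type*} [DecidableEq α] (f : Finset α → ℕ) {U V : Finset α}
    (hf : ∀ x, compress U V x ≠ x → f (compress U V x) < f x) (A : Finset (Finset α)) :
    ∑ x ∈ 𝓒 U V A, f x ≤ ∑ x ∈ A, f x ∧
      ((∃ x ∈ A, compress U V x ∉ A) → ∑ x ∈ 𝓒 U V A, f x < ∑ x ∈ A, f x) := by
  have hsum : ∑ x ∈ 𝓒 U V A, f x =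
      ∑ x ∈ A with compress U V x ∈ A, f x +
        ∑ x ∈ A with compress U V x ∉ A, f (compress U V x) := by
    rw [UV.compression, sum_union compress_disjoint, filter_image,
      sum_image compress_injOn]
  have hmoved : ∀ x ∈ A.filter (fun x => compress U V x ∉ A), f (compress U V x) < f x := by
    intro x hx
    rw [mem_filter] at hx
    exact hf x fun heq => hx.2 (heq.symm ▸ hx.1)
  rw [hsum, ← sum_filter_add_sum_filter_not A (fun x => compress U V x ∈ A) f]
  refine ⟨Nat.add_le_add_left (sum_le_sum fun x hx => (hmoved x hx).le) _, ?_⟩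
  rintro ⟨x, hx, hxA⟩
  exact Nat.add_lt_add_left (sum_lt_sum_of_nonempty ⟨x, mem_filter.2 ⟨hx, hxA⟩⟩ hmoved) _

lemma compress_card_lt {α : Type*} [DecidableEq α] {U V : Finset α}
    (hcard : #U < #V) (x : Finset α) (hx : compress U V x ≠ x) : #(compress U V x) < #x := by
  have hform : Disjoint U x ∧ V ⊆ x := by
    by_contra hno
    exact hx (if_neg hno)
  have hcx : compress U V x = (x ∪ U) \ V := compress_of_disjoint_of_le hform.1 hform.2
  rw [hcx, card_sdiff_of_subset (hform.2.trans subset_union_left),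
    card_union_of_disjoint hform.1.symm]
  have := card_le_card hform.2
  omega

lemma lt_compress_card {α : Type*} [DecidableEq α] {U V : Finset α}
    (hcard : #U < #V) (x : Finset α) (hx : compress V U x ≠ x) : #x < #(compress V U x) := by
  have hform : Disjoint V x ∧ U ⊆ x := by
    by_contra hno
    exact hx (if_neg hno)
  have hcx : compress V U x = (x ∪ V) \ U := compress_of_disjoint_of_le hform.1 hform.2
  rw [hcx, card_sdiff_of_subset (hform.2.trans subset_union_left),
    card_union_of_disjoint hform.1.symm]
  have := card_le_card hform.2
  omega

/-- A separated pair can be replaced by one with the same cardinalities that is stable under all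
compressions which lower `A` and raise `B` by one level. Each compression that changes the pair
lowers `∑ x ∈ A, #x + ∑ y ∈ B, #yᶜ`, and a smallest unstable `(U, V)` keeps it separated. -/
lemma IsSeparated.exists_stable {α : Type*} [DecidableEq α] [Fintype α]
    {A B : Finset (Finset α)} (h : IsSeparated A B) :
    ∃ A' B' : Finset (Finset α), #A' = #A ∧ #B' = #B ∧ IsSeparated A' B' ∧
      ∀ U V : Finset α, Disjoint U V → #V = #U + 1 →
        (∀ x ∈ A', compress U V x ∈ A') ∧ ∀ y ∈ B', compress V U y ∈ B' := by
  induction hN : ∑ x ∈ A, #x + ∑ y ∈ B, #yᶜ using Nat.strong_induction_on generalizing A B with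
  | _ N ih =>
    subst hN
    by_cases hst : ∀ j, ∀ U V : Finset α, #U = j → Disjoint U V → #V = #U + 1 →
        (∀ x ∈ A, compress U V x ∈ A) ∧ ∀ y ∈ B, compress V U y ∈ B
    · exact ⟨A, B, rfl, rfl, h, fun U V => hst _ U V rfl⟩
    · rw [not_forall] at hst
      obtain ⟨j, hspec, hmin⟩ := exists_minimal_of_wellFoundedLT _ hst
      push Not at hspec
      obtain ⟨U, V, hj, hUV, hcard, hbad⟩ := hspec
      have hsmall : ∀ u ∈ U, ∀ v ∈ V, (∀ x ∈ A, compress (U.erase u) (V.erase v) x ∈ A) ∧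
          ∀ y ∈ B, compress (V.erase v) (U.erase u) y ∈ B := by
        intro u hu v hv
        have hc := card_erase_add_one hu
        have hc' := card_erase_add_one hv
        have : ¬ _ := fun hnot => absurd (hmin (y := #(U.erase u)) hnot (by omega)) (by omega)
        exact not_not.1 this _ _ rfl (hUV.mono (erase_subset _ _) (erase_subset _ _)) (by omega)
      have hsep := h.compression hUV (by rintro rfl; simp at hcard; omega)
        (by rintro rfl; simp at hcard)
        (fun u hu v hv => (hsmall u hu v hv).1) (fun u hu v hv => (hsmall u hu v hv).2)
      have hAs := sum_compression_le (fun x => #x) (compress_card_lt (U := U) (V := V)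
        (by omega)) A
      have hBs := sum_compression_le (fun x => #xᶜ) (U := V) (V := U) (fun x hx => by
        have h1 := lt_compress_card (U := U) (V := V) (by omega) x hx
        have h2 := card_add_card_compl x
        have h3 := card_add_card_compl (compress V U x)
        omega) B
      have hlt : ∑ x ∈ 𝓒 U V A, #x + ∑ y ∈ 𝓒 V U B, #yᶜ < ∑ x ∈ A, #x + ∑ y ∈ B, #yᶜ := by
        by_cases hA : ∀ x ∈ A, compress U V x ∈ A
        · have := hBs.2 (by simpa using hbad hA)
          omega
        · push Not at hA
          have := hAs.2 hA
          omega
      obtain ⟨A', B', h1, h2, h3⟩ := ih _ hlt hsep rfl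
      exact ⟨A', B', h1.trans (card_compression _ _ _), h2.trans (card_compression _ _ _), h3⟩

/-- Stability under the compressions of one level down makes a family a Hamming ball: it contains
every set that is smaller than one of its members. -/
lemma mem_of_card_lt_of_stable {α : Type*} [DecidableEq α] {A : Finset (Finset α)}
    (hA : ∀ U V : Finset α, Disjoint U V → #V = #U + 1 → ∀ x ∈ A, compress U V x ∈ A)
    {x y : Finset α} (hx : x ∈ A) (hxy : #y < #x) : y ∈ A := by
  induction hd : #x - #y using Nat.strong_induction_on generalizing x with
  | _ d ih =>
    have h1 := card_sdiff_add_card_inter x y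
    have h2 := card_sdiff_add_card_inter y x
    rw [inter_comm] at h2
    by_cases hone : #x = #y + 1
    · have := hA (y \ x) (x \ y) (disjoint_sdiff_sdiff) (by omega) x hx
      rwa [compress_sdiff_sdiff] at this
    · obtain ⟨e, he⟩ : x.Nonempty := card_pos.1 (by omega)
      have hmem := hA ∅ {e} (by simp) (by simp) x hx
      have hcx : compress ∅ {e} x = x.erase e := by
        rw [compress_of_disjoint_of_le (by simp) (by simpa using he)]
        simp [sdiff_singleton_eq_erase]
      rw [hcx] at hmem
      have hc := card_erase_add_one he
      exact ih _ (by omega) hmem (by omega) rfl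

/-- The two-family form of Harper's theorem: a separated pair may be assumed to have every member
of `A` on a strictly lower level of the cube than every member of `B`. -/
lemma IsSeparated.exists_card_lt {α : Type*} [DecidableEq α] [Fintype α]
    {A B : Finset (Finset α)} (h : IsSeparated A B) :
    ∃ A' B' : Finset (Finset α), #A' = #A ∧ #B' = #B ∧ IsSeparated A' B' ∧
      ∀ x ∈ A', ∀ y ∈ B', #x < #y := by
  obtain ⟨A', B', hA, hB, hsep, hst⟩ := h.exists_stable
  refine ⟨A', B', hA, hB, hsep, fun x hx y hy => ?_⟩
  have hball : ∀ z, #z < #x → z ∈ A' := fun z hz =>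
    mem_of_card_lt_of_stable (fun U V h1 h2 => (hst U V h1 h2).1) hx hz
  by_contra hle
  have hself : y ∉ A' := fun hyA => by simpa using hsep y hyA y hy
  rcases y.eq_empty_or_nonempty with rfl | ⟨e, he⟩
  · rcases x.eq_empty_or_nonempty with rfl | hne
    · exact hself hx
    · exact hself (hball ∅ (by simpa using hne))
  · have hc := card_erase_add_one he
    refine hsep.not_agree_off (hball (y.erase e) (by omega)) hy e fun i hi => ?_
    simp [hi]

/-! ### Sizes of Hamming balls -/

lemma card_filter_card_eq (m j : ℕ) : #{z : Finset (Fin m) | #z = j} = m.choose j := by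
  rw [univ_filter_card_eq, card_powersetCard, card_fin]

lemma card_filter_lt_card (m j l : ℕ) (h : j + l = m) :
    #{z : Finset (Fin m) | l < #z} = #{z : Finset (Fin m) | #z < j} := by
  have hc : ∀ z : Finset (Fin m), #z + #zᶜ = m := fun z => by
    rw [card_add_card_compl, Fintype.card_fin]
  refine card_nbij' compl compl ?_ ?_ (fun _ _ => compl_compl _) (fun _ _ => compl_compl _)
  all_goals
    intro z hz
    have := hc z
    simp only [coe_filter, mem_univ, true_and, Set.mem_ofPred_eq] at hz ⊢
    omega

lemma card_filter_lt_add_eq_add_gt (m j : ℕ) :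
    #{z : Finset (Fin m) | #z < j} + m.choose j + #{z : Finset (Fin m) | j < #z} = 2 ^ m := by
  have h1 := card_filter_add_card_filter_not (s := (univ : Finset (Finset (Fin m))))
    (fun z => #z < j)
  have h2 := card_filter_add_card_filter_not
    (s := (univ : Finset (Finset (Fin m))).filter fun z => ¬ #z < j) (fun z => #z = j)
  rw [filter_filter, filter_filter] at h2
  have e1 : #{z : Finset (Fin m) | ¬ #z < j ∧ #z = j} = m.choose j := by
    rw [← card_filter_card_eq]
    congr 1
    ext z
    simp only [mem_filter, mem_univ, true_and]
    omega
  have e2 : #{z : Finset (Fin m) | ¬ #z < j ∧ ¬ #z = j} = #{z : Finset (Fin m) | j < #z} := by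
    congr 1
    ext z
    simp only [mem_filter, mem_univ, true_and]
    omega
  rw [card_univ, Fintype.card_finset, Fintype.card_fin] at h1
  omega

lemma card_filter_lt_add_one (m j : ℕ) :
    #{z : Finset (Fin m) | #z < j + 1} = #{z : Finset (Fin m) | #z < j} + m.choose j := by
  rw [← card_filter_card_eq, ← card_union_of_disjoint]
  · congr 1
    ext z
    simp only [mem_filter, mem_union, mem_univ, true_and]
    omega
  · rw [disjoint_filter]
    omega

/-! ### Upper bounds for separated pairs -/

lemma exists_le_card_of_lt {m j : ℕ} {A : Finset (Finset (Fin m))}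
    (h : #{z : Finset (Fin m) | #z < j} < #A) : ∃ x ∈ A, j ≤ #x := by
  by_contra! hno
  exact h.not_ge (card_le_card fun x hx => by simpa using hno x hx)

lemma exists_card_le_of_lt {m j : ℕ} {B : Finset (Finset (Fin m))}
    (h : #{z : Finset (Fin m) | j < #z} < #B) : ∃ y ∈ B, #y ≤ j := by
  by_contra! hno
  exact h.not_ge (card_le_card fun x hx => by simpa using hno x hx)

lemma IsSeparated.card_le_of_even {k : ℕ} {A B : Finset (Finset (Fin (2 * k)))}
    (h : IsSeparated A B) (hAB : #A = #B) :
    2 * #A + (2 * k).choose k ≤ 2 ^ (2 * k) := by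
  obtain ⟨A', B', hA, hB, -, hlt⟩ := h.exists_card_lt
  have h1 := card_filter_lt_add_eq_add_gt (2 * k) k
  have h2 := card_filter_lt_card (2 * k) k k (by omega)
  by_contra hno
  obtain ⟨x, hx, hxk⟩ := exists_le_card_of_lt (j := k) (A := A') (by omega)
  obtain ⟨y, hy, hyk⟩ := exists_card_le_of_lt (j := k) (B := B') (by omega)
  have := hlt x hx y hy
  omega

/-- In odd dimension `2 * k + 1` a large separated pair sits on the two sides of the middle; the
Kruskal–Katona theorem applied to the `(k + 1)`-sets of `B` then excludes too many `k`-sets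
from `A`. -/
lemma IsSeparated.card_le_of_odd {k : ℕ} {A B : Finset (Finset (Fin (2 * k + 1)))}
    (h : IsSeparated A B) (hAB : #A = #B) :
    #A + (2 * k).choose k ≤ 2 ^ (2 * k) := by
  obtain ⟨A', B', hA, hB, hsep, hlt⟩ := h.exists_card_lt
  rcases k.eq_zero_or_pos with rfl | hk
  · -- In dimension one any two sets are at distance at most one.
    have hA0 : A = ∅ := by
      rw [eq_empty_iff_forall_notMem]
      intro x hx
      obtain ⟨y, hy⟩ : B.Nonempty := card_pos.1 (hAB ▸ card_pos.2 ⟨x, hx⟩)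
      have h1 := h x hx y hy
      have h2 := card_le_univ (x ∆ y)
      simp only [Fintype.card_fin] at h2
      omega
    simp [hA0]
  have h1 := card_filter_lt_add_eq_add_gt (2 * k + 1) k
  have h2 := card_filter_lt_card (2 * k + 1) k (k + 1) (by omega)
  have h3 := card_filter_lt_card (2 * k + 1) (k + 1) k (by omega)
  have h4 := card_filter_lt_add_one (2 * k + 1) k
  have h5 : (2 * k + 1).choose (k + 1) = (2 * k).choose k + (2 * k).choose (k + 1) :=
    Nat.choose_succ_succ _ _
  have h6 : (2 * k + 1).choose (k + 1) = (2 * k + 1).choose k := Nat.choose_symm_half k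
  have hpow : 2 ^ (2 * k + 1) = 2 * 2 ^ (2 * k) := by ring
  by_contra hno
  obtain ⟨x₀, hx₀, hx₀k⟩ := exists_le_card_of_lt (j := k) (A := A') (by omega)
  obtain ⟨y₀, hy₀, hy₀k⟩ := exists_card_le_of_lt (j := k + 1) (B := B') (by omega)
  have hAk : ∀ x ∈ A', #x ≤ k := fun x hx => by
    have := hlt x hx y₀ hy₀
    omega
  have hBk : ∀ y ∈ B', k < #y := fun y hy => by
    have := hlt x₀ hx₀ y hy
    omega
  set L : Finset (Finset (Fin (2 * k + 1))) := B'.filter fun y => #y = k + 1 with hL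
  have hLcard : (2 * k).choose (k + 1) ≤ #L := by
    have hsplit := card_filter_add_card_filter_not (s := B') (fun y => #y = k + 1)
    have hrest : #{y ∈ B' | ¬ #y = k + 1} ≤ #{z : Finset (Fin (2 * k + 1)) | k + 1 < #z} := by
      refine card_le_card fun y hy => ?_
      rw [mem_filter] at hy
      have := hBk y hy.1
      simp only [mem_filter, mem_univ, true_and]
      omega
    rw [← hL] at hsplit
    omega
  have hsized : (L : Set (Finset (Fin (2 * k + 1)))).Sized (k + 1) := fun y hy =>
    (mem_filter.1 hy).2
  have hshadow : (2 * k).choose k ≤ #(∂ L) :=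
    kruskal_katona_lovasz_form (i := 1) (by omega) (by omega) (by omega) hsized hLcard
  have hdisj : Disjoint A' (∂ L) := by
    rw [disjoint_left]
    intro x hx hxL
    obtain ⟨y, hy, e, he, rfl⟩ := mem_shadow_iff.1 hxL
    exact hsep.not_agree_off hx (mem_filter.1 hy).1 e fun i hi => by simp [hi]
  have hunion : #(A' ∪ ∂ L) ≤ #{z : Finset (Fin (2 * k + 1)) | #z < k + 1} := by
    refine card_le_card (union_subset (fun x hx => ?_) fun x hx => ?_)
    · simpa using Nat.lt_succ_of_le (hAk x hx)
    · have : #x = k := hsized.shadow hx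
      simp [this]
  rw [card_union_of_disjoint hdisj] at hunion
  omega

/-! ### The even and the odd vertices as copies of a smaller cube -/

/-- The trace of a subset of `Fin (m + 1)` on the nonzero elements, as a subset of `Fin m`. It
maps the vertices of even size bijectively onto the cube of dimension `m`, and likewise those of
odd size. -/
def dropZero {m : ℕ} (x : Finset (Fin (m + 1))) : Finset (Fin m) := {i | i.succ ∈ x}

@[simp] lemma mem_dropZero {m : ℕ} {x : Finset (Fin (m + 1))} {i : Fin m} :
    i ∈ dropZero x ↔ i.succ ∈ x := by simp [dropZero]

lemma card_eq_card_dropZero_add {m : ℕ} (x : Finset (Fin (m + 1))) :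
    #x = #(dropZero x) + if 0 ∈ x then 1 else 0 := by
  have h := Fin.card_filter_univ_succ' (fun i => i ∈ x)
  rw [filter_mem_eq_inter, univ_inter] at h
  rw [h, add_comm]
  rfl

lemma dropZero_symmDiff {m : ℕ} (x y : Finset (Fin (m + 1))) :
    dropZero (x ∆ y) = dropZero x ∆ dropZero y := by
  ext i
  simp [mem_symmDiff]

lemma even_card_symmDiff_iff {α : Type*} [DecidableEq α] (x y : Finset α) :
    Even #(x ∆ y) ↔ (Even #x ↔ Even #y) := by
  have h1 := card_sdiff_add_card_inter x y
  have h2 := card_sdiff_add_card_inter y x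
  have h3 : #(x ∆ y) = #(x \ y) + #(y \ x) := card_union_of_disjoint disjoint_sdiff_sdiff
  rw [inter_comm] at h2
  rw [h3, ← h1, ← h2]
  simp only [Nat.even_add]
  tauto

lemma card_dropZero_symmDiff_bounds {m : ℕ} (x y : Finset (Fin (m + 1))) :
    #(dropZero x ∆ dropZero y) ≤ #(x ∆ y) ∧ #(x ∆ y) ≤ #(dropZero x ∆ dropZero y) + 1 := by
  have h := card_eq_card_dropZero_add (x ∆ y)
  rw [dropZero_symmDiff] at h
  split_ifs at h <;> omega

lemma eq_of_dropZero_eq {m : ℕ} {x y : Finset (Fin (m + 1))} (h : dropZero x = dropZero y)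
    (hp : Even #x ↔ Even #y) : x = y := by
  have h1 := (card_dropZero_symmDiff_bounds x y).2
  have h2 := (even_card_symmDiff_iff x y).2 hp
  rw [h, symmDiff_self, bot_eq_empty, card_empty] at h1
  obtain ⟨c, hc⟩ := h2
  rw [← symmDiff_eq_bot, bot_eq_empty, ← card_eq_zero]
  omega

lemma hypercube_adj_iff_of_parity {m : ℕ} {x y : Finset (Fin (m + 1))}
    (hp : ¬ (Even #x ↔ Even #y)) :
    (hypercube (m + 1)).Adj x y ↔ #(dropZero x ∆ dropZero y) < 2 := by
  have h1 := card_dropZero_symmDiff_bounds x y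
  have h2 := (even_card_symmDiff_iff x y).not.2 hp
  obtain ⟨c, hc⟩ := Nat.not_even_iff_odd.1 h2
  change #(x ∆ y) = 1 ↔ _
  omega

lemma not_hypercube_adj_of_parity {n : ℕ} {x y : Finset (Fin n)}
    (hp : Even #x ↔ Even #y) : ¬ (hypercube n).Adj x y := by
  intro h
  have h' : #(x ∆ y) = 1 := h
  have := (even_card_symmDiff_iff x y).2 hp
  rw [h'] at this
  simp at this

lemma exists_dropZero_eq {m : ℕ} (z : Finset (Fin m)) (p : Prop) :
    ∃ x : Finset (Fin (m + 1)), dropZero x = z ∧ (Even #x ↔ p) := by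
  have hd : dropZero (z.map (Fin.succEmb m)) = z := by
    ext i
    simp
  have hd' : dropZero (insert 0 (z.map (Fin.succEmb m))) = z := by
    ext i
    simp
  by_cases hp : Even #z ↔ p
  · exact ⟨_, hd, by rwa [card_map]⟩
  · refine ⟨_, hd', ?_⟩
    rw [card_insert_of_notMem (by simp), card_map, Nat.even_add_one]
    tauto

open Classical in
/-- Every subset of the smaller cube lifts to equally many vertices of either parity. -/
lemma card_filter_dropZero_mem {m : ℕ} (A : Finset (Finset (Fin m))) (p : Prop) :
    #{x : Finset (Fin (m + 1)) | (Even #x ↔ p) ∧ dropZero x ∈ A} = #A := by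
  refine card_nbij dropZero (fun x hx => ?_) (fun x hx y hy hxy => ?_) fun z hz => ?_
  · simp only [coe_filter, mem_univ, true_and, Set.mem_ofPred_eq] at hx
    exact hx.2
  · simp only [coe_filter, mem_univ, true_and, Set.mem_ofPred_eq] at hx hy
    exact eq_of_dropZero_eq hxy (hx.1.trans hy.1.symm)
  · obtain ⟨x, rfl, hx⟩ := exists_dropZero_eq z p
    refine ⟨x, ?_, rfl⟩
    simp only [coe_filter, mem_univ, true_and, Set.mem_ofPred_eq]
    exact ⟨hx, hz⟩

lemma card_filter_dropZero {m : ℕ} (A : Finset (Finset (Fin m))) :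
    #{x : Finset (Fin (m + 1)) | dropZero x ∈ A} = 2 * #A := by
  classical
  have h1 := card_filter_dropZero_mem A True
  have h2 := card_filter_dropZero_mem A False
  have h3 := card_filter_add_card_filter_not
    (s := ({x | dropZero x ∈ A} : Finset (Finset (Fin (m + 1))))) (fun x => Even #x)
  rw [filter_filter, filter_filter] at h3
  simp only [iff_true, iff_false, and_comm] at h1 h2 h3
  omega

/-! ### Balanced independent sets and separated pairs -/

lemma IsBalancedIndepSet.exists_isSeparated {m : ℕ} {S : Finset (Finset (Fin (m + 1)))}
    (hS : IsBalancedIndepSet (m + 1) S) :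
    ∃ A B : Finset (Finset (Fin m)), IsSeparated A B ∧ #A = #B ∧ #S = 2 * #A := by
  obtain ⟨hind, hbal⟩ := hS
  have hE : #((S.filter fun x => Even #x).image dropZero) = #(S.filter fun x => Even #x) :=
    card_image_of_injOn fun x hx y hy hxy => by
      simp only [coe_filter, Set.mem_ofPred_eq] at hx hy
      exact eq_of_dropZero_eq hxy (by tauto)
  have hO : #((S.filter fun x => Odd #x).image dropZero) = #(S.filter fun x => Odd #x) :=
    card_image_of_injOn fun x hx y hy hxy => by
      simp only [coe_filter, Set.mem_ofPred_eq, ← Nat.not_even_iff_odd] at hx hy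
      exact eq_of_dropZero_eq hxy (by tauto)
  refine ⟨_, _, ?_, hE.trans (hbal.trans hO.symm), ?_⟩
  · intro x' hx' y' hy'
    obtain ⟨x, hx, rfl⟩ := mem_image.1 hx'
    obtain ⟨y, hy, rfl⟩ := mem_image.1 hy'
    rw [mem_filter, ← Nat.not_even_iff_odd] at hy
    rw [mem_filter] at hx
    by_contra hlt
    exact hind (mem_coe.2 hx.1) (mem_coe.2 hy.1) (by rintro rfl; exact hy.2 hx.2)
      ((hypercube_adj_iff_of_parity (by tauto)).2 (not_le.1 hlt))
  · have := card_filter_add_card_filter_not (s := S) (fun x => Even #x)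
    simp only [Nat.not_even_iff_odd] at this
    omega

lemma IsSeparated.exists_isBalancedIndepSet {m : ℕ} {A B : Finset (Finset (Fin m))}
    (h : IsSeparated A B) (hAB : #A = #B) :
    ∃ S : Finset (Finset (Fin (m + 1))), IsBalancedIndepSet (m + 1) S ∧ #S = 2 * #A := by
  classical
  let S : Finset (Finset (Fin (m + 1))) :=
    {x | (Even #x ∧ dropZero x ∈ A) ∨ (Odd #x ∧ dropZero x ∈ B)}
  have hE : #(S.filter fun x => Even #x) = #A := by
    rw [← card_filter_dropZero_mem A True]
    congr 1
    ext x
    simp only [S, mem_filter, mem_univ, true_and, ← Nat.not_even_iff_odd]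
    tauto
  have hO : #(S.filter fun x => Odd #x) = #B := by
    rw [← card_filter_dropZero_mem B False]
    congr 1
    ext x
    simp only [S, mem_filter, mem_univ, true_and, ← Nat.not_even_iff_odd]
    tauto
  refine ⟨S, ⟨?_, hE.trans (hAB.trans hO.symm)⟩, ?_⟩
  · intro x hx y hy _ hadj
    by_cases hp : Even #x ↔ Even #y
    · exact not_hypercube_adj_of_parity hp hadj
    · rw [hypercube_adj_iff_of_parity hp] at hadj
      simp only [S, coe_filter, mem_univ, true_and, Set.mem_ofPred_eq,
        ← Nat.not_even_iff_odd] at hx hy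
      rcases hx with ⟨hx, hxA⟩ | ⟨hx, hxB⟩ <;> rcases hy with ⟨hy, hyA⟩ | ⟨hy, hyB⟩
      · tauto
      · exact hadj.not_ge (h _ hxA _ hyB)
      · exact hadj.not_ge (h.symm _ hxB _ hyA)
      · tauto
  · have := card_filter_add_card_filter_not (s := S) (fun x => Even #x)
    simp only [Nat.not_even_iff_odd] at this
    omega

/-! ### Extremal separated pairs -/

lemma card_le_card_add_card_symmDiff {α : Type*} [DecidableEq α] (x y : Finset α) :
    #y ≤ #x + #(x ∆ y) := by
  have h1 := card_sdiff_add_card_inter y x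
  have h2 : #(y ∩ x) ≤ #x := card_le_card inter_subset_right
  have h3 : #(y \ x) ≤ #(x ∆ y) := card_le_card subset_union_right
  omega

/-- In even dimension `2 * k`, the sets below and the sets above the middle layer. -/
lemma exists_isSeparated_even (k : ℕ) : ∃ A B : Finset (Finset (Fin (2 * k))),
    IsSeparated A B ∧ #A = #B ∧ 2 * #A + (2 * k).choose k = 2 ^ (2 * k) := by
  have h1 := card_filter_lt_add_eq_add_gt (2 * k) k
  have h2 := card_filter_lt_card (2 * k) k k (by omega)
  refine ⟨univ.filter fun z => #z < k, univ.filter fun z => k < #z, fun x hx y hy => ?_,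
    h2.symm, by omega⟩
  simp only [mem_filter, mem_univ, true_and] at hx hy
  have := card_le_card_add_card_symmDiff x y
  omega

/-- In odd dimension, the extremal pair of the cube of dimension one less, times an edge. -/
lemma exists_isSeparated_odd (k : ℕ) : ∃ A B : Finset (Finset (Fin (2 * k + 1))),
    IsSeparated A B ∧ #A = #B ∧ #A + (2 * k).choose k = 2 ^ (2 * k) := by
  obtain ⟨A, B, h, hAB, hcard⟩ := exists_isSeparated_even k
  refine ⟨univ.filter fun x => dropZero x ∈ A, univ.filter fun x => dropZero x ∈ B,
    fun x hx y hy => ?_, ?_, ?_⟩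
  · simp only [mem_filter, mem_univ, true_and] at hx hy
    exact (h _ hx _ hy).trans (card_dropZero_symmDiff_bounds x y).1
  · rw [card_filter_dropZero, card_filter_dropZero, hAB]
  · rw [card_filter_dropZero, hcard]

/-! ### The largest balanced independent set -/

theorem theorem1 (n : ℕ) (hn : 1 ≤ n) :
    (Even n →
      IsGreatest {m : ℤ | ∃ S : Finset (Finset (Fin n)), IsBalancedIndepSet n S ∧ (S.card : ℤ) = m}
        ((2 : ℤ) ^ (n - 1) - 2 * ((n - 2).choose ((n - 2) / 2) : ℤ))) ∧
    (Odd n →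
      IsGreatest {m : ℤ | ∃ S : Finset (Finset (Fin n)), IsBalancedIndepSet n S ∧ (S.card : ℤ) = m}
        ((2 : ℤ) ^ (n - 1) - ((n - 1).choose ((n - 1) / 2) : ℤ))) := by
  constructor
  · intro he
    obtain ⟨k, rfl⟩ : ∃ k, n = 2 * k + 1 + 1 := by
      obtain ⟨c, hc⟩ := he
      exact ⟨c - 1, by omega⟩
    have e1 : 2 * k + 1 + 1 - 1 = 2 * k + 1 := by omega
    have e2 : 2 * k + 1 + 1 - 2 = 2 * k := by omega
    have e3 : 2 * k / 2 = k := by omega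
    rw [e1, e2, e3, pow_succ]
    constructor
    · obtain ⟨A, B, h, hAB, hcard⟩ := exists_isSeparated_odd k
      obtain ⟨S, hS, hSA⟩ := h.exists_isBalancedIndepSet hAB
      refine ⟨S, hS, ?_⟩
      zify at hcard hSA
      linarith
    · rintro _ ⟨S, hS, rfl⟩
      obtain ⟨A, B, h, hAB, hSA⟩ := hS.exists_isSeparated
      have hcard := h.card_le_of_odd hAB
      zify at hcard hSA
      linarith
  · intro ho
    obtain ⟨k, rfl⟩ := ho
    have e1 : 2 * k + 1 - 1 = 2 * k := by omega
    have e3 : 2 * k / 2 = k := by omega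
    rw [e1, e3]
    constructor
    · obtain ⟨A, B, h, hAB, hcard⟩ := exists_isSeparated_even k
      obtain ⟨S, hS, hSA⟩ := h.exists_isBalancedIndepSet hAB
      refine ⟨S, hS, ?_⟩
      zify at hcard hSA
      linarith
    · rintro _ ⟨S, hS, rfl⟩
      obtain ⟨A, B, h, hAB, hSA⟩ := hS.exists_isSeparated
      have hcard := h.card_le_of_even hAB
      zify at hcard hSA
      linarith
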